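/- Fix a finite set of propositional variables. A Kripke model $A$ is a set with an accessibility relation $\to$, a subset $P^A$ for each propositional variable $P$, and a distinguished element $a$. A pathwise embedding is a map preserving $\to$ and the distinguished element, and preserving and reflecting the subsets $P$. Write $A\equiv^{\mathrm{ML}}B$ if the same formulas of propositional modal logic (with $\Box,\Diamond$) hold at the distinguished elements of $A$ and $B$; $A$ and $B$ are bisimilar if some bisimulation relates their distinguished elements. For $k\ge 1$ let $R_kA$ be the Kripke model of sequences $[a_0,\dots,a_j]$ with $a_0=a$, $a_\ell\to a_{\ell+1}$ for $0\le \ell<j$, and at most $k$ entries; here $s\to t$ iff $t$ extends $s$ by one entry, a sequence belongs to $P$ iff its last entry belongs to $P^A$, and the distinguished element is $[a]$. Let $\mathbf P_\omega$ be the category of paths and pathwise embeddings between them, a path being a Kripke model on $\{0,\dots,n\}$ for some $n\ge 0$ with $i\to j$ iff $j=i+1$, with distinguished element $0$, and with arbitrary subsets $P$. Let $\widehat{\mathbf P_\omega}=[\mathbf P_\omega^{\mathrm{op}},\mathbf{Set}]$. A Kripke model $C$ yields the presheaf sending a path $Q$ to the set of pathwise embeddings $Q\to C$, and for $C=R_kA$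 this presheaf is again written $R_kA$. Equip $\widehat{\mathbf P_\omega}$ with the model structure whose cofibrations are the monomorphisms and whose fibrant objects are the presheaves $X$ such that, for every arrow $i\colon P\to Q$ in $\mathbf P_\omega$, if there is an arrow $Q\to X$ then every arrow $P\to X$ extends along $i$ to an arrow $Q\to X$ (paths being identified with representable presheaves). Let $\omega$ be the ordinal category $1\to2\to3\to\cdots$, and equip $[\omega,\widehat{\mathbf P_\omega}]$ with the projective model structure: fibrations and weak equivalences are levelwise. Two objects of a model category are Morita equivalent if they are connected by a span of trivial fibrations (fibrations that are weak equivalences). Let $\mathcal R A\in[\omega,\widehat{\mathbf P_\omega}]$ be the chain of inclusions $R_1A\to R_2A\to R_3A\to\cdots$. **Proposition.** For any two Kripke models $A$ and $B$ the following are equivalent. 1. If $A\equiv^{\mathrm{ML}}B$, then $A$ and $B$ are bisimilar. 2. If $R_nA$ and $R_nB$ are Morita equivalent in $\widehat{\mathbf P_\omega}$ for every $n\ge1$, then $\mathcal R A$ and $\mathcal R B$ are Morita equivalent in $[\omega,\widehat{\mathbf P_\omega}]$. -/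

import Mathlib

universe u

open CategoryTheory Opposite Limits HomotopicalAlgebra

namespace ModalHomotopy

section Modal

/-! ### Modal logic -/

/-- Formulas of (unimodal) propositional modal logic over the propositional variables `Var`. -/
inductive Formula (Var : Type u) : Type u
  | var : Var → Formula Var
  | top : Formula Var
  | bot : Formula Var
  | and : Formula Var → Formula Var → Formula Var
  | or : Formula Var → Formula Var → Formula Var
  | neg : Formula Var → Formula Var
  | box : Formula Var → Formula Var
  | dia : Formula Var → Formula Var

/-- A (pointed) Kripke model. -/
structure KripkeModel (Var : Type u) where
  carrier : Type u
  /-- the accessibility relation -/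
  acc : carrier → carrier → Prop
  /-- `val p x` says that `x` belongs to the unary relation named by `p` -/
  val : Var → carrier → Prop
  /-- the distinguished element -/
  root : carrier

variable {Var : Type u}

/-- Truth of a formula at a point of a Kripke model. -/
def KripkeModel.Sat (A : KripkeModel Var) : A.carrier → Formula Var → Prop
  | x, .var p => A.val p x
  | _, .top => True
  | _, .bot => False
  | x, .and φ ψ => A.Sat x φ ∧ A.Sat x ψ
  | x, .or φ ψ => A.Sat x φ ∨ A.Sat x ψ
  | x, .neg φ => ¬ A.Sat x φ
  | x, .box φ => ∀ y, A.acc x y → A.Sat y φ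
  | x, .dia φ => ∃ y, A.acc x y ∧ A.Sat y φ

/-- `A` and `B` have the same modal theory (truth being evaluated at the distinguished element). -/
def ModallyEquivalent (A B : KripkeModel Var) : Prop :=
  ∀ φ : Formula Var, A.Sat A.root φ ↔ B.Sat B.root φ

/-- `A` and `B` are bisimilar: some bisimulation relates their distinguished elements. -/
def Bisimilar (A B : KripkeModel Var) : Prop :=
  ∃ Z : A.carrier → B.carrier → Prop,
    Z A.root B.root ∧
    (∀ x y, Z x y → ∀ p, A.val p x ↔ B.val p y) ∧
    (∀ x y x', Z x y → A.acc x x' → ∃ y', B.acc y y' ∧ Z x' y') ∧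
    (∀ x y y', Z x y → B.acc y y' → ∃ x', A.acc x x' ∧ Z x' y')

/-- Pathwise embeddings: homomorphisms of Kripke models that reflect the unary relations. -/
@[ext]
structure PathwiseEmbedding (A B : KripkeModel Var) : Type u where
  toFun : A.carrier → B.carrier
  map_acc : ∀ x y, A.acc x y → B.acc (toFun x) (toFun y)
  map_val : ∀ p x, A.val p x → B.val p (toFun x)
  reflect_val : ∀ p x, B.val p (toFun x) → A.val p x
  map_root : toFun A.root = B.root

/-- Kripke models and pathwise embeddings. -/
instance : Category.{u} (KripkeModel Var) where
  Hom A B := PathwiseEmbedding A B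
  id A := ⟨id, fun _ _ h => h, fun _ _ h => h, fun _ _ h => h, rfl⟩
  comp f g :=
    { toFun := g.toFun ∘ f.toFun
      map_acc := fun _ _ h => g.map_acc _ _ (f.map_acc _ _ h)
      map_val := fun _ _ h => g.map_val _ _ (f.map_val _ _ h)
      reflect_val := fun _ _ h => f.reflect_val _ _ (g.reflect_val _ _ h)
      map_root := by simp [f.map_root, g.map_root] }

/-! ### Partial unravellings -/

/-- The tree unravelling `R_k A` to depth `k`: nonempty sequences `[a₀, …, aⱼ]` with at most `k`
entries such that `a₀` is the distinguished element and each entry is accessible from the previous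
one. -/
def unravel (k : ℕ+) (A : KripkeModel Var) : KripkeModel Var where
  carrier := { s : List A.carrier //
    s.head? = some A.root ∧ s.IsChain A.acc ∧ s.length ≤ (k : ℕ) }
  acc s t := ∃ x, t.1 = s.1 ++ [x]
  val p s := ∃ x, s.1.getLast? = some x ∧ A.val p x
  root := ⟨[A.root], rfl, List.isChain_singleton _, k.2⟩

/-- The inclusion `R_k A → R_l A` for `k ≤ l`. -/
def unravelInclusion {k l : ℕ+} (h : k ≤ l) (A : KripkeModel Var) :
    unravel k A ⟶ unravel l A where
  toFun s := ⟨s.1, s.2.1, s.2.2.1, s.2.2.2.trans h⟩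
  map_acc _ _ h := h
  map_val _ _ h := h
  reflect_val _ _ h := h
  map_root := rfl

/-- The chain of Kripke models `R_1 A → R_2 A → R_3 A → ⋯`. -/
def unravelChain (A : KripkeModel Var) : ℕ+ ⥤ KripkeModel Var where
  obj k := unravel k A
  map f := unravelInclusion (leOfHom f) A

/-! ### Paths and presheaves over paths -/

/-- A path: a finite nonempty chain `0 → 1 → ⋯ → length` with an arbitrary valuation. These form
a skeleton of the finite synchronization trees whose tree order is a chain. -/
structure Path (Var : Type u) where
  length : ℕ
  val : Var → Fin (length + 1) → Prop

/-- The Kripke model underlying a path. -/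
def Path.toKripke (P : Path Var) : KripkeModel Var where
  carrier := ULift.{u} (Fin (P.length + 1))
  acc i j := j.down.val = i.down.val + 1
  val p i := P.val p i.down
  root := ⟨0⟩

/-- The category `P_ω` of paths and pathwise embeddings (a full subcategory). -/
instance : Category.{u} (Path Var) where
  Hom P Q := P.toKripke ⟶ Q.toKripke
  id P := 𝟙 P.toKripke
  comp f g := CategoryStruct.comp (obj := KripkeModel Var) f g

/-- The inclusion of the category of paths. -/
def Path.incl (Var : Type u) : Path Var ⥤ KripkeModel Var where
  obj P := P.toKripke
  map f := f

/-- The category of presheaves on the category of paths. -/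
abbrev PathPresheaf (Var : Type u) := (Path Var)ᵒᵖ ⥤ Type u

/-- The restricted Yoneda embedding `A ↦ Hom(-, A)`. -/
def restrictedYoneda (Var : Type u) : KripkeModel Var ⥤ PathPresheaf Var :=
  yoneda ⋙ (Functor.whiskeringLeft _ _ _).obj (Path.incl Var).op

/-- The chain `R_1 A → R_2 A → R_3 A → ⋯` as an object of `[ω, presheaves on P_ω]`, where `ω` is
the ordinal category `1 → 2 → 3 → ⋯`. -/
def chain (A : KripkeModel Var) : ℕ+ ⥤ PathPresheaf Var :=
  unravelChain A ⋙ restrictedYoneda Var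

end Modal

/-! ### The model structure on presheaves over paths

It is the model structure whose cofibrations are the monomorphisms and whose fibrant objects are
those of `IsFibrantPresheaf`. As usual for such structures, weak equivalences are the
maps that induce bijections on homotopy classes of maps to fibrant objects, with respect to the
cylinder `X ⨿ X ≅ X × (1 + 1)`, and fibrations have the right lifting property with respect to
trivial cofibrations. -/

section ModelStructure

variable {Var : Type u}

/-- The lifting property defining fibrant presheaves. -/
def IsFibrantPresheaf (X : PathPresheaf Var) : Prop :=
  ∀ ⦃P Q : Path Var⦄ (i : P ⟶ Q), Nonempty (yoneda.obj Q ⟶ X) →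
    ∀ p : yoneda.obj P ⟶ X, ∃ q : yoneda.obj Q ⟶ X, yoneda.map i ≫ q = p

/-- Homotopy of maps with respect to the cylinder `X ⨿ X`. -/
def Homotopic {X Y : PathPresheaf Var} (f g : X ⟶ Y) : Prop :=
  ∃ η : X ⨿ X ⟶ Y, coprod.inl ≫ η = f ∧ coprod.inr ≫ η = g

/-- Homotopy classes of maps. -/
def HoClass (X Y : PathPresheaf Var) : Type u := Quot (Homotopic (X := X) (Y := Y))

/-- Precomposition `[Y, Z] → [X, Z]` with `f : X ⟶ Y`. -/
def HoClass.precomp {X Y : PathPresheaf Var} (f : X ⟶ Y) (Z : PathPresheaf Var) :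
    HoClass Y Z → HoClass X Z :=
  Quot.map (fun g => f ≫ g) (by
    rintro _ _ ⟨η, rfl, rfl⟩
    exact ⟨coprod.map f f ≫ η, by rw [← Category.assoc, coprod.inl_map, Category.assoc],
      by rw [← Category.assoc, coprod.inr_map, Category.assoc]⟩)

instance : CategoryWithCofibrations (PathPresheaf Var) where
  cofibrations := MorphismProperty.monomorphisms _

instance : CategoryWithWeakEquivalences (PathPresheaf Var) where
  weakEquivalences := fun _ _ f =>
    ∀ Z, IsFibrantPresheaf Z → Function.Bijective (HoClass.precomp f Z)

instance : CategoryWithFibrations (PathPresheaf Var) where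
  fibrations := (trivialCofibrations (PathPresheaf Var)).rlp

end ModelStructure

/-! ### Verification of the model category axioms -/

section Axioms

variable {Var : Type u}

lemma homotopic_of {X Y : PathPresheaf Var} (f g : X ⟶ Y) : Homotopic f g :=
  ⟨coprod.desc f g, coprod.inl_desc _ _, coprod.inr_desc _ _⟩

instance (X Y : PathPresheaf Var) : Subsingleton (HoClass X Y) := by
  constructor
  rintro ⟨f⟩ ⟨g⟩
  exact Quot.sound (homotopic_of f g)

lemma bijective_precomp_iff {X Y : PathPresheaf Var} (f : X ⟶ Y) (Z : PathPresheaf Var) :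
    Function.Bijective (HoClass.precomp f Z) ↔ (Nonempty (X ⟶ Z) → Nonempty (Y ⟶ Z)) := by
  constructor
  · rintro ⟨-, h⟩ ⟨g⟩
    obtain ⟨⟨k⟩, -⟩ := h (Quot.mk _ g)
    exact ⟨k⟩
  · refine fun h => ⟨fun _ _ _ => Subsingleton.elim _ _, ?_⟩
    rintro ⟨g⟩
    obtain ⟨k⟩ := h ⟨g⟩
    exact ⟨Quot.mk _ k, Subsingleton.elim _ _⟩

/-- Elementwise form of the lifting property of fibrant presheaves. -/
lemma isFibrantPresheaf_iff (X : PathPresheaf Var) :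
    IsFibrantPresheaf X ↔ ∀ ⦃P Q : Path Var⦄ (i : P ⟶ Q), Nonempty (X.obj (op Q)) →
      Function.Surjective (X.map i.op) := by
  constructor
  · rintro h P Q i ⟨x⟩ p
    obtain ⟨q, hq⟩ := h i ⟨yonedaEquiv.symm x⟩ (yonedaEquiv.symm p)
    refine ⟨yonedaEquiv q, ?_⟩
    rw [yonedaEquiv_naturality, hq, Equiv.apply_symm_apply]
  · rintro h P Q i ⟨x⟩ p
    obtain ⟨q, hq⟩ := h i ⟨yonedaEquiv x⟩ (yonedaEquiv p)
    refine ⟨yonedaEquiv.symm q, yonedaEquiv.injective ?_⟩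
    rw [← yonedaEquiv_naturality, Equiv.apply_symm_apply, hq]

/-! #### Morphisms of paths -/

lemma Path.hom_apply {P Q : Path Var} (f : P ⟶ Q) (i : ULift.{u} (Fin (P.length + 1))) :
    (PathwiseEmbedding.toFun f i).down.val = i.down.val := by
  obtain ⟨⟨i, hi⟩⟩ := i
  induction i with
  | zero => exact congrArg (fun j => j.down.val) (PathwiseEmbedding.map_root f)
  | succ i ih =>
    have h := PathwiseEmbedding.map_acc f ⟨⟨i, by omega⟩⟩ ⟨⟨i + 1, hi⟩⟩ rfl
    change _ = _ + 1 at h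
    rw [h, ih]

instance (P Q : Path Var) : Subsingleton (P ⟶ Q) := by
  constructor
  intro f g
  apply PathwiseEmbedding.ext
  funext i
  apply ULift.ext
  apply Fin.ext
  exact (Path.hom_apply f i).trans (Path.hom_apply g i).symm

lemma Path.length_le {P Q : Path Var} (f : P ⟶ Q) : P.length ≤ Q.length := by
  have h := Path.hom_apply f ⟨Fin.last _⟩
  have h' := (PathwiseEmbedding.toFun f ⟨Fin.last _⟩).down.isLt
  rw [h] at h'
  exact Nat.lt_succ_iff.1 h'

/-- A path of length `n + 1` with its last element removed. -/
def Path.trunc (n : ℕ) (v : Var → Fin (n + 1 + 1) → Prop) : Path Var :=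
  ⟨n, fun p i => v p i.castSucc⟩

/-- The inclusion of the truncation. -/
def Path.truncHom (n : ℕ) (v : Var → Fin (n + 1 + 1) → Prop) :
    Path.trunc n v ⟶ (⟨n + 1, v⟩ : Path Var) where
  toFun i := ⟨i.down.castSucc⟩
  map_acc _ _ h := h
  map_val _ _ h := h
  reflect_val _ _ h := h
  map_root := rfl

lemma Path.hom_val {P Q : Path Var} (f : P ⟶ Q) (p : Var) (i : ℕ) (hi : i < P.length + 1)
    (hi' : i < Q.length + 1) : P.val p ⟨i, hi⟩ ↔ Q.val p ⟨i, hi'⟩ := by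
  have e : PathwiseEmbedding.toFun f ⟨⟨i, hi⟩⟩ = (⟨⟨i, hi'⟩⟩ : ULift (Fin (Q.length + 1))) := by
    apply ULift.ext
    apply Fin.ext
    exact Path.hom_apply f _
  have h₁ := PathwiseEmbedding.map_val f p ⟨⟨i, hi⟩⟩
  have h₂ := PathwiseEmbedding.reflect_val f p ⟨⟨i, hi⟩⟩
  rw [e] at h₁ h₂
  exact ⟨h₁, h₂⟩

lemma Path.eq_of_hom {P Q : Path Var} (f : P ⟶ Q) (h : P.length = Q.length) : P = Q := by
  have hv := Path.hom_val f
  obtain ⟨n, v⟩ := P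
  obtain ⟨m, w⟩ := Q
  dsimp only at h
  subst h
  congr 1
  funext p i
  exact propext (hv p i.1 i.2 i.2)

lemma Path.exists_hom_trunc {P : Path Var} {n : ℕ} {v : Var → Fin (n + 1 + 1) → Prop}
    (f : P ⟶ (⟨n + 1, v⟩ : Path Var)) (h : P.length ≤ n) : Nonempty (P ⟶ Path.trunc n v) := by
  refine ⟨⟨fun i => ⟨⟨i.down.val, ?_⟩⟩, fun i j hij => hij, fun p i hi => ?_, fun p i hi => ?_, rfl⟩⟩
  · have := i.down.isLt
    change _ < n + 1
    omega
  · have h1 := i.down.isLt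
    exact (Path.hom_val f p i.down.val h1 (by change _ < n + 1 + 1; omega)).1 hi
  · have h1 := i.down.isLt
    exact (Path.hom_val f p i.down.val h1 (by change _ < n + 1 + 1; omega)).2 hi

/-! #### Maps into fibrant presheaves -/

section Extend

variable {A Z F : PathPresheaf Var} (i : A ⟶ Z) (a : A ⟶ F) (hF : IsFibrantPresheaf F)
  (hS : ∀ Q, Nonempty (Z.obj Q) → Nonempty (F.obj Q))

open Classical in
/-- An extension along `i` of a map `a` to a fibrant presheaf, by recursion on the length of
paths. -/
noncomputable def extendAux : ∀ (n : ℕ) (v : Var → Fin (n + 1) → Prop),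
    Z.obj (op ⟨n, v⟩) → F.obj (op ⟨n, v⟩)
  | 0, _, z => if h : ∃ x, i.app _ x = z then a.app _ h.choose else (hS _ ⟨z⟩).some
  | n + 1, v, z => if h : ∃ x, i.app _ x = z then a.app _ h.choose else
    ((isFibrantPresheaf_iff F).1 hF (Path.truncHom n v) (hS _ ⟨z⟩)
      (extendAux n (fun p i => v p i.castSucc) (Z.map (Path.truncHom n v).op z))).choose

lemma extendAux_incl [Mono i] (n : ℕ) (v : Var → Fin (n + 1) → Prop) (x : A.obj (op ⟨n, v⟩)) :
    extendAux i a hF hS n v (i.app _ x) = a.app _ x := by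
  have hi : Function.Injective (i.app (op ⟨n, v⟩)) :=
    (CategoryTheory.mono_iff_injective _).1 inferInstance
  have h : ∃ x', i.app _ x' = i.app (op ⟨n, v⟩) x := ⟨x, rfl⟩
  cases n <;> rw [extendAux, dif_pos h, hi h.choose_spec]

lemma extendAux_succ [Mono i] (n : ℕ) (v : Var → Fin (n + 1 + 1) → Prop)
    (z : Z.obj (op ⟨n + 1, v⟩)) :
    F.map (Path.truncHom n v).op (extendAux i a hF hS (n + 1) v z) =
      extendAux i a hF hS n (fun p i => v p i.castSucc) (Z.map (Path.truncHom n v).op z) := by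
  by_cases h : ∃ x, i.app _ x = z
  · obtain ⟨x, rfl⟩ := h
    rw [extendAux_incl, ← NatTrans.naturality_apply, ← NatTrans.naturality_apply]
    exact (extendAux_incl i a hF hS n _ _).symm
  · rw [extendAux, dif_neg h]
    exact ((isFibrantPresheaf_iff F).1 hF (Path.truncHom n v) (hS _ ⟨z⟩)
      (extendAux i a hF hS n (fun p i => v p i.castSucc)
        (Z.map (Path.truncHom n v).op z))).choose_spec

lemma extendAux_natural [Mono i] (n : ℕ) (v : Var → Fin (n + 1) → Prop) (z : Z.obj (op ⟨n, v⟩))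
    (P : Path Var) (f : P ⟶ ⟨n, v⟩) :
    F.map f.op (extendAux i a hF hS n v z) =
      extendAux i a hF hS P.length P.val (Z.map f.op z) := by
  have key : ∀ (Q : Path Var) (g : P ⟶ Q) (w : Z.obj (op Q)), P.length = Q.length →
      F.map g.op (extendAux i a hF hS Q.length Q.val w) =
        extendAux i a hF hS P.length P.val (Z.map g.op w) := by
    intro Q g w h
    obtain rfl := Path.eq_of_hom g h
    obtain rfl : g = 𝟙 P := Subsingleton.elim _ _
    rw [op_id, F.map_id, Z.map_id]
    rfl
  induction n with
  | zero => exact key ⟨0, v⟩ f z (Nat.le_zero.1 (Path.length_le f))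
  | succ n ih =>
    by_cases h : P.length ≤ n
    · obtain ⟨g⟩ := Path.exists_hom_trunc f h
      obtain rfl : f = g ≫ Path.truncHom n v := Subsingleton.elim _ _
      have h₁ := ih (fun p i => v p i.castSucc) (Z.map (Path.truncHom n v).op z) g
      rw [← extendAux_succ] at h₁
      rw [op_comp, F.map_comp, Z.map_comp]
      exact h₁
    · exact key ⟨n + 1, v⟩ f z (le_antisymm (Path.length_le f) (by change n + 1 ≤ _; omega))

end Extend

lemma exists_extension {A Z F : PathPresheaf Var} (i : A ⟶ Z) [Mono i] (a : A ⟶ F)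
    (hF : IsFibrantPresheaf F) (hS : ∀ Q, Nonempty (Z.obj Q) → Nonempty (F.obj Q)) :
    ∃ l : Z ⟶ F, i ≫ l = a := by
  refine ⟨{ app := fun Q => TypeCat.ofHom (extendAux i a hF hS Q.unop.length Q.unop.val)
            naturality := ?_ }, ?_⟩
  · intro Q P f
    ext z
    exact (extendAux_natural i a hF hS _ _ z P.unop f.unop).symm
  · ext Q x
    exact extendAux_incl i a hF hS _ _ x

/-! #### Weak equivalences -/

/-- The subterminal presheaf on the support of `X`. -/
def support (X : PathPresheaf Var) : PathPresheaf Var where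
  obj Q := ULift.{u} (PLift (Nonempty (X.obj Q)))
  map f := TypeCat.ofHom fun h => ⟨⟨h.down.down.map (X.map f)⟩⟩

lemma support_fibrant (X : PathPresheaf Var) : IsFibrantPresheaf (support X) := by
  rw [isFibrantPresheaf_iff]
  rintro P Q i ⟨q⟩ p
  exact ⟨q, rfl⟩

lemma weakEquivalences_iff {X Y : PathPresheaf Var} (f : X ⟶ Y) :
    weakEquivalences _ f ↔ ∀ Q, Nonempty (Y.obj Q) → Nonempty (X.obj Q) := by
  constructor
  · intro h Q ⟨y⟩
    obtain ⟨k⟩ := (bijective_precomp_iff f _).1 (h _ (support_fibrant X))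
      ⟨{ app := fun Q => TypeCat.ofHom fun x => ⟨⟨⟨x⟩⟩⟩ }⟩
    exact (k.app Q y).down.down
  · intro h Z hZ
    refine (bijective_precomp_iff f Z).2 fun ⟨k⟩ => ?_
    obtain ⟨l, -⟩ := exists_extension (initial.to Y) (initial.to Z) hZ
      fun Q hQ => (h Q hQ).map (k.app Q)
    exact ⟨l⟩

instance : (weakEquivalences (PathPresheaf Var)).HasTwoOutOfThreeProperty where
  comp_mem f g hf hg := by
    rw [weakEquivalences_iff] at *
    exact fun Q h => hf Q (hg Q h)
  of_postcomp f g hg hfg := by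
    rw [weakEquivalences_iff] at *
    exact fun Q h => hfg Q (h.map (g.app Q))
  of_precomp f g hf hfg := by
    rw [weakEquivalences_iff] at *
    exact fun Q h => (hfg Q h).map (f.app Q)

/-! #### Factorisations -/

section PartialMaps

variable {X Y : PathPresheaf Var}

/-- Sections of `Y` together with a partial lift along `f : X ⟶ Y`. -/
@[ext]
structure PartialLift (f : X ⟶ Y) (Q : (Path Var)ᵒᵖ) : Type u where
  pt : Y.obj Q
  graph : ∀ P : (Path Var)ᵒᵖ, (Q ⟶ P) → Set (X.obj P)
  unique : ∀ P h, ∀ x ∈ graph P h, ∀ x' ∈ graph P h, x = x'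
  closed : ∀ P h, ∀ x ∈ graph P h, ∀ P' (g : P ⟶ P'), X.map g x ∈ graph P' (h ≫ g)
  overlies : ∀ P h, ∀ x ∈ graph P h, f.app P x = Y.map h pt

/-- The presheaf of sections of `Y` together with a partial lift along `f`. -/
def partialLifts (f : X ⟶ Y) : PathPresheaf Var where
  obj Q := PartialLift f Q
  map {Q Q'} k := TypeCat.ofHom fun z =>
    { pt := Y.map k z.pt
      graph := fun P h => z.graph P (k ≫ h)
      unique := fun P h => z.unique P _
      closed := fun P h x hx P' g => by
        rw [← Category.assoc]
        exact z.closed P _ x hx P' g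
      overlies := fun P h x hx => by
        rw [z.overlies P _ x hx, Y.map_comp]
        rfl }
  map_id Q := by
    ext z : 3
    apply PartialLift.ext
    · simp
    · funext P h
      exact congrArg (z.graph P) (Category.id_comp h)
  map_comp k l := by
    ext z : 3
    apply PartialLift.ext
    · simp
    · funext P h
      exact congrArg (z.graph P) (Category.assoc k l h)

/-- The projection of partial lifts. -/
def partialLiftsProj (f : X ⟶ Y) : partialLifts f ⟶ Y where
  app Q := TypeCat.ofHom fun z => z.pt

/-- The inclusion of total lifts. -/
def partialLiftsIncl (f : X ⟶ Y) : X ⟶ partialLifts f where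
  app Q := TypeCat.ofHom fun x =>
    { pt := f.app Q x
      graph := fun P h => {X.map h x}
      unique := by
        rintro P h _ rfl _ rfl
        rfl
      closed := by
        rintro P h _ rfl P' g
        rw [X.map_comp]
        rfl
      overlies := by
        rintro P h _ rfl
        exact NatTrans.naturality_apply f h x }
  naturality Q P k := by
    ext x : 3
    apply PartialLift.ext
    · exact NatTrans.naturality_apply f k x
    · funext R h
      change {X.map h (X.map k x)} = ({X.map (k ≫ h) x} : Set _)
      rw [X.map_comp]
      rfl

lemma partialLiftsIncl_proj (f : X ⟶ Y) : partialLiftsIncl f ≫ partialLiftsProj f = f := rfl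

lemma partialLiftsIncl_injective (f : X ⟶ Y) (Q : (Path Var)ᵒᵖ) :
    Function.Injective ((partialLiftsIncl f).app Q) := by
  intro x x' h
  have h₁ : ({X.map (𝟙 Q) x} : Set (X.obj Q)) = {X.map (𝟙 Q) x'} :=
    congrFun (congrFun (congrArg PartialLift.graph h) Q) (𝟙 Q)
  rw [Set.singleton_eq_singleton_iff, X.map_id] at h₁
  exact h₁

lemma mono_iff_injective (f : X ⟶ Y) : Mono f ↔ ∀ Q, Function.Injective (f.app Q) := by
  rw [NatTrans.mono_iff_mono_app]
  simp only [CategoryTheory.mono_iff_injective]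

lemma partialLift_lift (f : X ⟶ Y) {A B : PathPresheaf Var} (i : A ⟶ B) [Mono i]
    (a : A ⟶ partialLifts f) (b : B ⟶ Y) (w : a ≫ partialLiftsProj f = i ≫ b) :
    ∃ l : B ⟶ partialLifts f, i ≫ l = a ∧ l ≫ partialLiftsProj f = b := by
  have hi := (mono_iff_injective i).1 inferInstance
  have w' : ∀ Q x, (a.app Q x).pt = b.app Q (i.app Q x) := fun Q x =>
    congrArg (fun t : A ⟶ Y => t.app Q x) w
  have ha : ∀ P P' (g : P ⟶ P') (x : A.obj P),
      a.app P' (A.map g x) = (partialLifts f).map g (a.app P x) := fun P P' g x =>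
    NatTrans.naturality_apply a g x
  refine ⟨{ app := fun Q => TypeCat.ofHom fun y =>
      { pt := b.app Q y
        graph := fun P h => {x | ∃ z, i.app P z = B.map h y ∧ x ∈ (a.app P z).graph P (𝟙 P)}
        unique := ?_
        closed := ?_
        overlies := ?_ }
            naturality := ?_ }, ?_, ?_⟩
  · rintro P h x ⟨z, hz, hx⟩ x' ⟨z', hz', hx'⟩
    obtain rfl := hi P (hz.trans hz'.symm)
    exact (a.app P z).unique _ _ x hx x' hx'
  · rintro P h x ⟨z, hz, hx⟩ P' g
    refine ⟨A.map g z, ?_, ?_⟩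
    · rw [NatTrans.naturality_apply, hz, B.map_comp]
      rfl
    · rw [ha]
      have := (a.app P z).closed _ _ x hx P' g
      rw [Category.id_comp] at this
      change _ ∈ (a.app P z).graph P' (g ≫ 𝟙 P')
      rwa [Category.comp_id]
  · rintro P h x ⟨z, hz, hx⟩
    rw [(a.app P z).overlies _ _ x hx, w', hz, NatTrans.naturality_apply, Y.map_id]
    rfl
  · intro Q Q' k
    ext y : 3
    apply PartialLift.ext
    · exact NatTrans.naturality_apply b k y
    · funext P h
      change {x | ∃ z, i.app P z = B.map h (B.map k y) ∧ _} =
        {x | ∃ z, i.app P z = B.map (k ≫ h) y ∧ _}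
      rw [B.map_comp]
      rfl
  · ext Q x : 5
    apply PartialLift.ext
    · exact (w' Q x).symm
    · funext P h
      change {t | ∃ z, i.app P z = B.map h (i.app Q x) ∧ t ∈ (a.app P z).graph P (𝟙 P)} =
        (a.app Q x).graph P h
      have e : (a.app P (A.map h x)).graph P (𝟙 P) = (a.app Q x).graph P h := by
        rw [ha]
        exact congrArg ((a.app Q x).graph P) (Category.comp_id h)
      rw [← e]
      ext t
      constructor
      · rintro ⟨z, hz, ht⟩
        rw [← NatTrans.naturality_apply i h x] at hz
        rwa [← hi P hz]
      · exact fun ht => ⟨_, NatTrans.naturality_apply i h x, ht⟩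
  · rfl

/-- The part of `partialLifts f` lying over the support of `X`. -/
def supportedLifts (f : X ⟶ Y) : Subfunctor (partialLifts f) where
  obj Q := {_z | Nonempty (X.obj Q)}
  map k _ h := h.map (X.map k)

end PartialMaps

lemma rlp_mono_weakEquivalence {X Y : PathPresheaf Var} (p : X ⟶ Y)
    (hp : (MorphismProperty.monomorphisms _).rlp p) : weakEquivalences _ p := by
  rw [weakEquivalences_iff]
  rintro Q ⟨y⟩
  have : Mono (initial.to (yoneda.obj Q.unop : PathPresheaf Var)) := inferInstance
  have := hp _ this
  have sq : CommSq (initial.to X) (initial.to (yoneda.obj Q.unop : PathPresheaf Var)) p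
    (yonedaEquiv.symm y) := ⟨Subsingleton.elim _ _⟩
  exact ⟨yonedaEquiv sq.lift⟩

lemma rlp_partialLiftsProj {X Y : PathPresheaf Var} (f : X ⟶ Y) :
    (MorphismProperty.monomorphisms _).rlp (partialLiftsProj f) := by
  intro A B i (hi : Mono i)
  constructor
  intro a b sq
  obtain ⟨l, h₁, h₂⟩ := partialLift_lift f i a b sq.w
  exact ⟨⟨l, h₁, h₂⟩⟩

lemma trivialFibrations_eq :
    trivialFibrations (PathPresheaf Var) = (MorphismProperty.monomorphisms _).rlp := by
  ext X Y p
  constructor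
  · rintro ⟨hp, hw⟩
    have hi : weakEquivalences _ (partialLiftsIncl p) :=
      (weakEquivalences (PathPresheaf Var)).of_postcomp _ (partialLiftsProj p)
        (rlp_mono_weakEquivalence _ (rlp_partialLiftsProj p)) hw
    have := hp _ ⟨(mono_iff_injective _).2 (partialLiftsIncl_injective p), hi⟩
    have sq : CommSq (𝟙 X) (partialLiftsIncl p) p (partialLiftsProj p) := ⟨by
      rw [partialLiftsIncl_proj, Category.id_comp]⟩
    refine MorphismProperty.of_retract (P := (MorphismProperty.monomorphisms _).rlp) ?_
      (rlp_partialLiftsProj p)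
    exact
      { i := Arrow.homMk (partialLiftsIncl p) (𝟙 Y) (by
          exact (partialLiftsIncl_proj p).trans (Category.comp_id p).symm)
        r := Arrow.homMk sq.lift (𝟙 Y) (by
          exact sq.fac_right.trans (Category.comp_id _).symm)
        retract := Arrow.hom_ext _ _ sq.fac_left (Category.comp_id _) }
  · exact fun hp => ⟨fun _ _ i hi => hp i hi.1, rlp_mono_weakEquivalence p hp⟩

instance : (cofibrations (PathPresheaf Var)).IsStableUnderRetracts :=
  inferInstanceAs (MorphismProperty.monomorphisms _).IsStableUnderRetracts

instance : (weakEquivalences (PathPresheaf Var)).IsStableUnderRetracts where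
  of_retract {X Y Z W f g} h hg := by
    rw [weakEquivalences_iff] at *
    exact fun Q hQ => (hg Q (hQ.map (h.i.right.app Q))).map (h.r.left.app Q)

instance : MorphismProperty.IsWeakFactorizationSystem (cofibrations (PathPresheaf Var))
    (trivialFibrations (PathPresheaf Var)) := by
  have : (trivialFibrations (PathPresheaf Var)).IsStableUnderRetracts := by
    rw [trivialFibrations_eq]
    infer_instance
  have : MorphismProperty.HasFactorization (cofibrations (PathPresheaf Var))
      (trivialFibrations (PathPresheaf Var)) := ⟨fun f => ⟨
    { Z := partialLifts f
      i := partialLiftsIncl f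
      p := partialLiftsProj f
      fac := partialLiftsIncl_proj f
      hi := (mono_iff_injective _).2 (partialLiftsIncl_injective f)
      hp := by
        rw [trivialFibrations_eq]
        exact rlp_partialLiftsProj f }⟩⟩
  refine MorphismProperty.IsWeakFactorizationSystem.mk' _ _ fun i p hi hp => ?_
  rw [trivialFibrations_eq] at hp
  exact hp i hi

lemma rlp_supportedLifts {X Y : PathPresheaf Var} (f : X ⟶ Y) :
    fibrations _ ((supportedLifts f).ι ≫ partialLiftsProj f) := by
  rintro A B i ⟨(hi : Mono i), hw⟩
  rw [weakEquivalences_iff] at hw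
  constructor
  intro a b sq
  obtain ⟨l, h₁, h₂⟩ := partialLift_lift f i (a ≫ (supportedLifts f).ι) b (by
    rw [Category.assoc]; exact sq.w)
  have hl : Subfunctor.range l ≤ supportedLifts f := by
    rintro Q _ ⟨y, rfl⟩
    obtain ⟨x⟩ := hw Q ⟨y⟩
    exact (a.app Q x).2
  refine ⟨⟨Subfunctor.lift l hl, ?_, ?_⟩⟩
  · rw [← cancel_mono (supportedLifts f).ι, Category.assoc, Subfunctor.lift_ι, h₁]
  · rw [← Category.assoc, Subfunctor.lift_ι, h₂]

/-- The inclusion of `X` in `supportedLifts f`. -/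
def supportedLiftsIncl {X Y : PathPresheaf Var} (f : X ⟶ Y) : X ⟶ (supportedLifts f).toFunctor :=
  Subfunctor.lift (partialLiftsIncl f) (by
    rintro Q _ ⟨x, rfl⟩
    exact ⟨x⟩)

lemma supportedLiftsIncl_ι {X Y : PathPresheaf Var} (f : X ⟶ Y) :
    supportedLiftsIncl f ≫ (supportedLifts f).ι = partialLiftsIncl f := rfl

lemma trivialCofibrations_supportedLiftsIncl {X Y : PathPresheaf Var} (f : X ⟶ Y) :
    trivialCofibrations _ (supportedLiftsIncl f) := by
  constructor
  · have : Mono (supportedLiftsIncl f ≫ (supportedLifts f).ι) :=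
      (mono_iff_injective _).2 (partialLiftsIncl_injective f)
    exact mono_of_mono _ (supportedLifts f).ι
  · rw [weakEquivalences_iff]
    rintro Q ⟨z⟩
    exact z.2

instance : MorphismProperty.IsWeakFactorizationSystem (trivialCofibrations (PathPresheaf Var))
    (fibrations (PathPresheaf Var)) := by
  have : (trivialCofibrations (PathPresheaf Var)).IsStableUnderRetracts :=
    inferInstanceAs (cofibrations (PathPresheaf Var) ⊓ weakEquivalences _).IsStableUnderRetracts
  have : (fibrations (PathPresheaf Var)).IsStableUnderRetracts :=
    inferInstanceAs (trivialCofibrations (PathPresheaf Var)).rlp.IsStableUnderRetracts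
  have : MorphismProperty.HasFactorization (trivialCofibrations (PathPresheaf Var))
      (fibrations (PathPresheaf Var)) := ⟨fun f => ⟨
    { Z := (supportedLifts f).toFunctor
      i := supportedLiftsIncl f
      p := (supportedLifts f).ι ≫ partialLiftsProj f
      fac := partialLiftsIncl_proj f
      hi := trivialCofibrations_supportedLiftsIncl f
      hp := rlp_supportedLifts f }⟩⟩
  exact MorphismProperty.IsWeakFactorizationSystem.mk' _ _ fun i p hi hp => hp i hi

/-- The model structure on presheaves over paths. -/
instance : ModelCategory (PathPresheaf Var) := ModelCategory.mk' _

/-- The fibrant objects of the model structure are the fibrant presheaves. -/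
theorem isFibrant_iff_isFibrantPresheaf (X : PathPresheaf Var) :
    IsFibrant X ↔ IsFibrantPresheaf X := by
  rw [isFibrant_iff, fibration_iff]
  constructor
  · intro h
    rw [isFibrantPresheaf_iff]
    rintro P Q i ⟨q⟩ p
    let f := terminal.from X
    have := h _ (trivialCofibrations_supportedLiftsIncl f)
    have sq : CommSq (𝟙 X) (supportedLiftsIncl f) f (terminal.from _) :=
      ⟨Subsingleton.elim _ _⟩
    have hi : Mono i := ⟨fun _ _ _ => Subsingleton.elim _ _⟩
    obtain ⟨l, hl, -⟩ := partialLift_lift f (yoneda.map i)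
      (yonedaEquiv.symm (((partialLiftsIncl f).app (op P)) p)) (terminal.from _)
      (Subsingleton.elim _ _)
    let z : (supportedLifts f).toFunctor.obj (op Q) := ⟨yonedaEquiv l, ⟨q⟩⟩
    refine ⟨sq.lift.app (op Q) z, ?_⟩
    rw [← NatTrans.naturality_apply]
    have e : (supportedLifts f).toFunctor.map i.op z =
        (supportedLiftsIncl f).app (op P) p := by
      apply Subtype.ext
      change (partialLifts f).map i.op (yonedaEquiv l) = (partialLiftsIncl f).app (op P) p
      rw [yonedaEquiv_naturality, hl, Equiv.apply_symm_apply]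
    rw [e]
    exact congrArg (fun t : X ⟶ X => t.app (op P) p) sq.fac_left
  · rintro h A B i ⟨(hi : Mono i), hw⟩
    rw [weakEquivalences_iff] at hw
    constructor
    intro a b sq
    obtain ⟨l, hl⟩ := exists_extension i a h fun Q hQ => (hw Q hQ).map (a.app Q)
    exact ⟨⟨l, hl, Subsingleton.elim _ _⟩⟩

end Axioms

/-! ### Chains of presheaves and Morita equivalence -/

section Morita

variable {Var : Type u}

/-- Fibrations of the projective model structure on `[ω, presheaves on P_ω]`. -/
instance : CategoryWithFibrations (ℕ+ ⥤ PathPresheaf Var) where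
  fibrations := fun _ _ α => ∀ n, fibrations _ (α.app n)

/-- Weak equivalences of the projective model structure on `[ω, presheaves on P_ω]`. -/
instance : CategoryWithWeakEquivalences (ℕ+ ⥤ PathPresheaf Var) where
  weakEquivalences := fun _ _ α => ∀ n, weakEquivalences _ (α.app n)

/-- Cofibrations of the projective model structure on `[ω, presheaves on P_ω]`. -/
instance : CategoryWithCofibrations (ℕ+ ⥤ PathPresheaf Var) where
  cofibrations := (trivialFibrations (ℕ+ ⥤ PathPresheaf Var)).llp

/-- `X` and `Y` are Morita equivalent: they are connected by a span of trivial fibrations. -/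
def MoritaEquivalent {C : Type*} [Category C] [CategoryWithFibrations C]
    [CategoryWithWeakEquivalences C] (X Y : C) : Prop :=
  ∃ (Z : C) (f : Z ⟶ X) (g : Z ⟶ Y), trivialFibrations C f ∧ trivialFibrations C g

/-- Two chains of presheaves are levelwise Morita equivalent. -/
def LevelwiseMoritaEquivalent (F G : ℕ+ ⥤ PathPresheaf Var) : Prop :=
  ∀ n, MoritaEquivalent (F.obj n) (G.obj n)

end Morita

end ModalHomotopy

/-! Each hypothesis or conclusion about Morita equivalence translates into a logical one, and the
proposition is then a rewriting: `moritaEquivalent_chain_iff_bisimilar` matches spans of chains with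
bisimulations, and `levelwiseMoritaEquivalent_chain_iff_modallyEquivalent` matches levelwise spans
with modal equivalence.

Trivial fibrations are the maps lifting against all monomorphisms. Between presheaves on paths this
amounts to surjectivity on one-point paths and lifting along the addition of one final point
(`trivialFibration_of_lift_trunc`). A section of `R_k A` is a path in `A` with at most `k` points,
so such liftings are moves of a back-and-forth game with `k - 1` rounds. A section of the apex of a
span gives a pair of endpoints, one in each model, and the liftings make these pairs a winning
strategy. Conversely, a depth-indexed relation with the back and forth properties is itself a Kripke
model (`relationModel`), and its projections unravel to trivial fibrations.

For a single level the game is bounded. Being related at every bound is modal equivalence, by the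
Hennessy–Milner argument with characteristic formulas, which uses the finiteness of `Var`. For a
span of chains the apex sections at all levels are linked, so a section with no room left moves up
one level; the bound disappears and a bisimulation results. -/

namespace ModalHomotopy

/-! ### Bounded bisimilarity -/

section BoundedBisimilarity

variable {Var : Type u}

/-- Points related by a back-and-forth game with `n` rounds. -/
def BoundedBisimilar (A B : KripkeModel Var) : ℕ → A.carrier → B.carrier → Prop
  | 0, x, y => ∀ p, A.val p x ↔ B.val p y
  | n + 1, x, y => (∀ p, A.val p x ↔ B.val p y) ∧
      (∀ x', A.acc x x' → ∃ y', B.acc y y' ∧ BoundedBisimilar A B n x' y') ∧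
      (∀ y', B.acc y y' → ∃ x', A.acc x x' ∧ BoundedBisimilar A B n x' y')

variable {A B : KripkeModel Var}

lemma BoundedBisimilar.val {n : ℕ} {x : A.carrier} {y : B.carrier}
    (h : BoundedBisimilar A B n x y) (p : Var) : A.val p x ↔ B.val p y := by
  cases n with
  | zero => exact h p
  | succ n => exact h.1 p

/-- The nesting depth of modalities. -/
def Formula.depth : Formula Var → ℕ
  | .var _ => 0
  | .top => 0
  | .bot => 0
  | .and φ ψ => max φ.depth ψ.depth
  | .or φ ψ => max φ.depth ψ.depth
  | .neg φ => φ.depth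
  | .box φ => φ.depth + 1
  | .dia φ => φ.depth + 1

/-- Each modality costs one round of the game: its subformula is compared at successors matched by
the back or the forth clause, with one round fewer. -/
lemma BoundedBisimilar.sat_iff (φ : Formula Var) {n : ℕ} (hn : φ.depth ≤ n) {x : A.carrier}
    {y : B.carrier} (h : BoundedBisimilar A B n x y) : A.Sat x φ ↔ B.Sat y φ := by
  induction φ generalizing n x y with
  | var p => exact h.val p
  | top => exact Iff.rfl
  | bot => exact Iff.rfl
  | and φ ψ ihφ ihψ =>
    exact and_congr (ihφ ((le_max_left _ _).trans hn) h) (ihψ ((le_max_right _ _).trans hn) h)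
  | or φ ψ ihφ ihψ =>
    exact or_congr (ihφ ((le_max_left _ _).trans hn) h) (ihψ ((le_max_right _ _).trans hn) h)
  | neg φ ih => exact not_congr (ih hn h)
  | box φ ih =>
    obtain ⟨n, rfl⟩ : ∃ m, n = m + 1 := Nat.exists_eq_add_of_le' ((Nat.le_add_left 1 _).trans hn)
    have hn := Nat.le_of_succ_le_succ hn
    constructor
    · intro hx y' hy'
      obtain ⟨x', hx', h'⟩ := h.2.2 y' hy'
      exact (ih hn h').1 (hx x' hx')
    · intro hy x' hx'
      obtain ⟨y', hy', h'⟩ := h.2.1 x' hx'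
      exact (ih hn h').2 (hy y' hy')
  | dia φ ih =>
    obtain ⟨n, rfl⟩ : ∃ m, n = m + 1 := Nat.exists_eq_add_of_le' ((Nat.le_add_left 1 _).trans hn)
    have hn := Nat.le_of_succ_le_succ hn
    constructor
    · rintro ⟨x', hx', hs⟩
      obtain ⟨y', hy', h'⟩ := h.2.1 x' hx'
      exact ⟨y', hy', (ih hn h').1 hs⟩
    · rintro ⟨y', hy', hs⟩
      obtain ⟨x', hx', h'⟩ := h.2.2 y' hy'
      exact ⟨x', hx', (ih hn h').2 hs⟩

/-- The formula is chosen before the model, so that one formula can be used to compare points of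
different models. -/
lemma exists_finite_conjunction {ι : Type*} [Finite ι] (φ : ι → Formula Var) :
    ∃ ψ : Formula Var, ∀ (A : KripkeModel Var) (x : A.carrier),
      A.Sat x ψ ↔ ∀ i, A.Sat x (φ i) := by
  classical
  have := Fintype.ofFinite ι
  have key : ∀ s : Finset ι, ∃ ψ : Formula Var, ∀ (A : KripkeModel Var) (x : A.carrier),
      A.Sat x ψ ↔ ∀ i ∈ s, A.Sat x (φ i) := by
    intro s
    induction s using Finset.induction_on with
    | empty => exact ⟨.top, fun A x => by simp [KripkeModel.Sat]⟩
    | insert i s _ ih =>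
      obtain ⟨ψ, hψ⟩ := ih
      exact ⟨.and (φ i) ψ, fun A x => by simp [KripkeModel.Sat, hψ]⟩
  obtain ⟨ψ, hψ⟩ := key Finset.univ
  exact ⟨ψ, fun A x => by simp [hψ]⟩

lemma exists_type_formula {ι : Type*} [Finite ι] (φ : ι → Formula Var) (s : Set ι) :
    ∃ ψ : Formula Var, ∀ (A : KripkeModel Var) (x : A.carrier),
      A.Sat x ψ ↔ ∀ i, A.Sat x (φ i) ↔ i ∈ s := by
  classical
  obtain ⟨ψ, hψ⟩ := exists_finite_conjunction fun i => if i ∈ s then φ i else .neg (φ i)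
  refine ⟨ψ, fun A x => (hψ A x).trans (forall_congr' fun i => ?_)⟩
  by_cases hi : i ∈ s <;> simp [hi, KripkeModel.Sat]

/-- Up to `n` rounds there are only finitely many types of points, each cut out by a formula. A type
for `n + 1` rounds records which variables hold and which types for `n` rounds occur among the
successors; finiteness of `Var` keeps the index set finite, so that the conjunctions exist. Types
need not exclude one another: it suffices that every point has one and that a shared one wins the
game. -/
lemma exists_characteristic_formulas [Finite Var] (n : ℕ) :
    ∃ (ι : Type u) (_ : Finite ι) (χ : ι → Formula Var),
      (∀ (A : KripkeModel Var) (x : A.carrier), ∃ i, A.Sat x (χ i)) ∧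
      ∀ (A B : KripkeModel Var) (x : A.carrier) (y : B.carrier) (i : ι),
        A.Sat x (χ i) → B.Sat y (χ i) → BoundedBisimilar A B n x y := by
  choose β hβ using exists_type_formula (Formula.var (Var := Var))
  have hval : ∀ (A B : KripkeModel Var) (x : A.carrier) (y : B.carrier) (v : Set Var),
      A.Sat x (β v) → B.Sat y (β v) → ∀ p, A.val p x ↔ B.val p y := fun A B x y v hx hy p =>
    ((hβ v A x).1 hx p).trans ((hβ v B y).1 hy p).symm
  induction n with
  | zero =>
    exact ⟨Set Var, inferInstance, β,
      fun A x => ⟨{p | A.val p x}, (hβ _ A x).2 fun p => Iff.rfl⟩, hval⟩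
  | succ n ih =>
    obtain ⟨ι, _, χ, hχ, hn⟩ := ih
    choose δ hδ using exists_type_formula fun i => (χ i).dia
    refine ⟨Set Var × Set ι, inferInstance, fun t => .and (β t.1) (δ t.2), fun A x =>
      ⟨⟨{p | A.val p x}, {i | A.Sat x (χ i).dia}⟩, (hβ _ A x).2 fun p => Iff.rfl,
        (hδ _ A x).2 fun i => Iff.rfl⟩, ?_⟩
    rintro A B x y ⟨v, s⟩ ⟨hx, hx'⟩ ⟨hy, hy'⟩
    refine ⟨hval A B x y v hx hy, fun x' h => ?_, fun y' h => ?_⟩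
    · obtain ⟨i, hi⟩ := hχ A x'
      -- A type realised by a successor of `x` belongs to `s`, hence is realised by a successor of
      -- `y`.
      obtain ⟨y', h', hy⟩ := ((hδ s B y).1 hy' i).2 (((hδ s A x).1 hx' i).1 ⟨x', h, hi⟩)
      exact ⟨y', h', hn A B x' y' i hi hy⟩
    · obtain ⟨i, hi⟩ := hχ B y'
      obtain ⟨x', h', hx⟩ := ((hδ s A x).1 hx' i).2 (((hδ s B y).1 hy' i).1 ⟨y', h, hi⟩)
      exact ⟨x', h', hn A B x' y' i hx hi⟩

theorem modallyEquivalent_iff_forall_boundedBisimilar [Finite Var] :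
    ModallyEquivalent A B ↔ ∀ n, BoundedBisimilar A B n A.root B.root := by
  constructor
  · intro h n
    obtain ⟨ι, _, χ, hχ, hn⟩ := exists_characteristic_formulas (Var := Var) n
    obtain ⟨i, hi⟩ := hχ A A.root
    exact hn A B _ _ i hi ((h _).1 hi)
  · exact fun h φ => (h φ.depth).sat_iff φ le_rfl

end BoundedBisimilarity

/-! ### Embeddings of paths in unravellings -/

section Sections

variable {Var : Type u} {k : ℕ+} {A : KripkeModel Var} {P Q : Path Var}

lemma unravel_ne_nil (t : (unravel k A).carrier) : t.1 ≠ [] := by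
  intro h
  have := t.2.1
  simp [h] at this

/-- The root is a one-entry sequence and every step of the path appends one entry. -/
lemma length_toFun (s : Q.toKripke ⟶ unravel k A) (i : ℕ) (hi : i < Q.length + 1) :
    (PathwiseEmbedding.toFun s ⟨⟨i, hi⟩⟩).1.length = i + 1 := by
  induction i with
  | zero =>
    have h := PathwiseEmbedding.map_root s
    exact (congrArg (fun t => t.1.length) h).trans rfl
  | succ i ih =>
    obtain ⟨x, hx⟩ := PathwiseEmbedding.map_acc s ⟨⟨i, by omega⟩⟩ ⟨⟨i + 1, hi⟩⟩ rfl
    rw [hx, List.length_append, ih]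
    rfl

/-- The last point of `A` visited by a path in an unravelling of `A`. -/
def endpoint (s : Q.toKripke ⟶ unravel k A) : A.carrier :=
  (PathwiseEmbedding.toFun s ⟨Fin.last _⟩).1.getLast (unravel_ne_nil _)

lemma length_lt (s : Q.toKripke ⟶ unravel k A) : Q.length + 1 ≤ k := by
  rw [← length_toFun s Q.length (Nat.lt_succ_self _)]
  exact (PathwiseEmbedding.toFun s _).2.2.2

lemma val_endpoint (s : Q.toKripke ⟶ unravel k A) (p : Var) :
    A.val p (endpoint s) ↔ Q.val p (Fin.last _) := by
  constructor
  · intro h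
    exact PathwiseEmbedding.reflect_val s p ⟨Fin.last _⟩ ⟨_, List.getLast?_eq_getLast_of_ne_nil _, h⟩
  · intro h
    obtain ⟨x, hx, hv⟩ := PathwiseEmbedding.map_val s p ⟨Fin.last _⟩ h
    rw [List.getLast?_eq_getLast_of_ne_nil (unravel_ne_nil _)] at hx
    obtain rfl := Option.some_injective _ hx
    exact hv

/-- The restriction of an embedding along a morphism of paths. -/
def restrict {X : KripkeModel Var} (f : P ⟶ Q) (s : Q.toKripke ⟶ X) : P.toKripke ⟶ X :=
  (Path.incl Var).map f ≫ s

lemma restrict_comp {X Y : KripkeModel Var} (f : P ⟶ Q) (s : Q.toKripke ⟶ X) (g : X ⟶ Y) :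
    restrict f (s ≫ g) = restrict f s ≫ g :=
  (Category.assoc _ _ _).symm

lemma toFun_restrict (f : P ⟶ Q) (s : Q.toKripke ⟶ unravel k A) (i : ℕ)
    (hi : i < P.length + 1) (hi' : i < Q.length + 1) :
    PathwiseEmbedding.toFun (restrict f s) ⟨⟨i, hi⟩⟩ =
      PathwiseEmbedding.toFun s ⟨⟨i, hi'⟩⟩ := by
  refine congrArg (PathwiseEmbedding.toFun s) ?_
  apply ULift.ext
  apply Fin.ext
  exact Path.hom_apply f _

lemma toFun_last (f : P ⟶ Q) (h : Q.length = P.length + 1) (s : Q.toKripke ⟶ unravel k A) :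
    (PathwiseEmbedding.toFun s ⟨Fin.last _⟩).1 =
      (PathwiseEmbedding.toFun (restrict f s) ⟨Fin.last _⟩).1 ++ [endpoint s] := by
  obtain ⟨x, hx⟩ := PathwiseEmbedding.map_acc s ⟨⟨P.length, by omega⟩⟩ ⟨Fin.last _⟩ h
  have e : endpoint s = x := by
    unfold endpoint
    simp only [hx, List.getLast_append_singleton]
  rw [e, hx]
  exact congrArg (fun t => t.1 ++ [x]) (toFun_restrict f s _ _ _).symm

/-- The accessibility condition at the junction of the earlier sequence and its appended last entry.
-/
lemma acc_endpoint (f : P ⟶ Q) (h : Q.length = P.length + 1) (s : Q.toKripke ⟶ unravel k A) :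
    A.acc (endpoint (restrict f s)) (endpoint s) := by
  have hc := (PathwiseEmbedding.toFun s ⟨Fin.last _⟩).2.2.1
  rw [toFun_last f h, List.isChain_append] at hc
  exact hc.2.2 _ (by rw [List.getLast?_eq_getLast_of_ne_nil (unravel_ne_nil _)]; rfl) _ rfl

/-- Unravellings are trees: all earlier points are seen by the restriction, and the last sequence is
the previous one with the endpoint appended. This gives the uniqueness complementing
`exists_extend_hom_unravel`. -/
lemma hom_unravel_ext (f : P ⟶ Q) (h : Q.length = P.length + 1) {s t : Q.toKripke ⟶ unravel k A}
    (hf : restrict f s = restrict f t) (he : endpoint s = endpoint t) :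
    s = t := by
  apply PathwiseEmbedding.ext
  funext ⟨⟨i, hi⟩⟩
  by_cases hP : i < P.length + 1
  · rw [← toFun_restrict f s i hP hi, ← toFun_restrict f t i hP hi, hf]
  · obtain rfl : i = Q.length := by omega
    apply Subtype.ext
    exact (toFun_last f h s).trans ((by rw [hf, he]) : _ = _) |>.trans (toFun_last f h t).symm

lemma toFun_zero (s : Q.toKripke ⟶ unravel k A) (h : Q.length = 0) :
    PathwiseEmbedding.toFun s ⟨Fin.last _⟩ = (unravel k A).root := by
  rw [← PathwiseEmbedding.map_root s]
  refine congrArg (PathwiseEmbedding.toFun s) ?_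
  apply ULift.ext
  apply Fin.ext
  exact h

lemma endpoint_zero (s : Q.toKripke ⟶ unravel k A) (h : Q.length = 0) : endpoint s = A.root := by
  unfold endpoint
  simp only [toFun_zero s h]
  rfl

lemma hom_unravel_eq_of_length_zero (h : Q.length = 0) (s t : Q.toKripke ⟶ unravel k A) :
    s = t := by
  apply PathwiseEmbedding.ext
  funext ⟨i⟩
  obtain rfl : i = Fin.last _ := by
    apply Fin.ext
    have := i.isLt
    simp only [Fin.val_last]
    omega
  rw [toFun_zero s h, toFun_zero t h]

lemma exists_hom_unravel_zero (h : Q.length = 0)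
    (hv : ∀ p, A.val p A.root ↔ Q.val p (Fin.last _)) : Nonempty (Q.toKripke ⟶ unravel k A) := by
  have hi : ∀ i : Q.toKripke.carrier, i.down = Fin.last _ := fun i => by
    apply Fin.ext
    have := i.down.isLt
    simp only [Fin.val_last]
    omega
  refine ⟨⟨fun _ => (unravel k A).root, fun i j hij => ?_, fun p i hp => ?_, fun p i hp => ?_, rfl⟩⟩
  · have := j.down.isLt
    change j.down.val = _ at hij
    omega
  · refine ⟨A.root, rfl, (hv p).2 ?_⟩
    rw [← hi i]
    exact hp
  · obtain ⟨x, hx, hp⟩ := hp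
    obtain rfl := Option.some_injective _ hx
    change Q.val p i.down
    rw [hi i]
    exact (hv p).1 hp

lemma exists_extend_hom_unravel (f : P ⟶ Q) (h : Q.length = P.length + 1) (hk : Q.length + 1 ≤ k)
    (s : P.toKripke ⟶ unravel k A) (x : A.carrier) (hx : A.acc (endpoint s) x)
    (hv : ∀ p, A.val p x ↔ Q.val p (Fin.last _)) :
    ∃ t : Q.toKripke ⟶ unravel k A, restrict f t = s ∧ endpoint t = x := by
  -- The image of the new last point. Its membership proof is where `hk` is needed: the sequence has
  -- one entry more than `P` has points.
  let e : (unravel k A).carrier := ⟨(PathwiseEmbedding.toFun s ⟨Fin.last _⟩).1 ++ [x], by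
    rw [List.head?_append_of_ne_nil _ (unravel_ne_nil _)]
    exact (PathwiseEmbedding.toFun s _).2.1, by
    rw [List.isChain_append]
    refine ⟨(PathwiseEmbedding.toFun s _).2.2.1, List.isChain_singleton _, ?_⟩
    rw [List.getLast?_eq_getLast_of_ne_nil (unravel_ne_nil _)]
    rintro _ ⟨⟩ _ ⟨⟩
    exact hx, by
    have := length_toFun s P.length (Nat.lt_succ_self _)
    rw [List.length_append]
    change List.length (PathwiseEmbedding.toFun s ⟨⟨P.length, _⟩⟩).1 + 1 ≤ _
    omega⟩
  have he : ∀ p, (unravel k A).val p e ↔ A.val p x := fun p => by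
    constructor
    · rintro ⟨y, hy, hp⟩
      rw [List.getLast?_concat] at hy
      obtain rfl := Option.some_injective _ hy
      exact hp
    · exact fun hp => ⟨x, List.getLast?_concat, hp⟩
  have hval : ∀ (i : Q.toKripke.carrier) p, (unravel k A).val p
      (if hi : i.down.val < P.length + 1 then PathwiseEmbedding.toFun s ⟨⟨i.down.val, hi⟩⟩ else e) ↔
        Q.toKripke.val p i := by
    rintro ⟨⟨i, hi⟩⟩ p
    by_cases hP : i < P.length + 1
    · rw [dif_pos hP]
      exact Iff.trans ⟨PathwiseEmbedding.reflect_val s p _, PathwiseEmbedding.map_val s p _⟩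
        (Path.hom_val f p i hP hi)
    · rw [dif_neg hP, he, hv]
      obtain rfl : i = Q.length := by omega
      exact Iff.rfl
  let t : Q.toKripke ⟶ unravel k A :=
    { toFun := fun i => if hi : i.down.val < P.length + 1 then
        PathwiseEmbedding.toFun s ⟨⟨i.down.val, hi⟩⟩ else e
      map_acc := by
        rintro ⟨⟨i, hi⟩⟩ ⟨⟨j, hj⟩⟩ hij
        obtain rfl : j = i + 1 := hij
        have hP : i < P.length + 1 := by omega
        by_cases hP' : i + 1 < P.length + 1
        · rw [dif_pos hP, dif_pos hP']
          exact PathwiseEmbedding.map_acc s _ _ rfl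
        · rw [dif_pos hP, dif_neg hP']
          obtain rfl : i = P.length := by omega
          exact ⟨x, rfl⟩
      map_val := fun p i hp => (hval i p).2 hp
      reflect_val := fun p i hp => (hval i p).1 hp
      map_root := by
        refine (dif_pos (Nat.succ_pos _)).trans ?_
        exact PathwiseEmbedding.map_root s }
  refine ⟨t, ?_, ?_⟩
  · apply PathwiseEmbedding.ext
    funext ⟨⟨i, hi⟩⟩
    rw [toFun_restrict f t i hi (by omega)]
    exact dif_pos hi
  · have ht : PathwiseEmbedding.toFun t ⟨Fin.last _⟩ = e :=
      dif_neg (by simp only [Fin.val_last]; omega)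
    unfold endpoint
    simp only [ht]
    exact List.getLast_append_singleton _

/-- A path prolonged by one point. -/
def Path.extend (Q : Path Var) (w : Var → Prop) : Path Var :=
  ⟨Q.length + 1, fun p => Fin.snoc (α := fun _ => Prop) (Q.val p) (w p)⟩

/-- The inclusion of a path in its prolongation. -/
def Path.extendHom (Q : Path Var) (w : Var → Prop) : Q ⟶ Q.extend w where
  toFun i := ⟨i.down.castSucc⟩
  map_acc _ _ h := h
  map_val p i h := by
    change Fin.snoc (α := fun _ => Prop) (Q.val p) (w p) i.down.castSucc
    rw [Fin.snoc_castSucc]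
    exact h
  reflect_val p i h := by
    change Fin.snoc (α := fun _ => Prop) (Q.val p) (w p) i.down.castSucc at h
    rw [Fin.snoc_castSucc] at h
    exact h
  map_root := rfl

/-- The valuation on the new point has to be that of `x`, since pathwise embeddings reflect the
variables as well as preserve them. -/
lemma exists_prolongation (s : Q.toKripke ⟶ unravel k A) (hk : Q.length + 2 ≤ k) (x : A.carrier)
    (hx : A.acc (endpoint s) x) :
    ∃ t : (Q.extend fun p => A.val p x).toKripke ⟶ unravel k A,
      restrict (Q.extendHom _) t = s ∧ endpoint t = x := by
  refine exists_extend_hom_unravel (Q.extendHom _) rfl hk s x hx fun p => ?_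
  change _ ↔ Fin.snoc (α := fun _ => Prop) (Q.val p) (A.val p x) (Fin.last _)
  rw [Fin.snoc_last]

/-- Unravelling is functorial. -/
def unravelMap (k : ℕ+) {C : KripkeModel Var} (h : C ⟶ A) : unravel k C ⟶ unravel k A where
  toFun s := ⟨s.1.map (PathwiseEmbedding.toFun h), by
      rw [List.head?_map, s.2.1]
      exact congrArg some (PathwiseEmbedding.map_root h),
    (List.isChain_map _).2 (s.2.2.1.imp fun _ _ => PathwiseEmbedding.map_acc h _ _), by
    rw [List.length_map]
    exact s.2.2.2⟩
  map_acc := by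
    rintro s t ⟨x, hx⟩
    exact ⟨PathwiseEmbedding.toFun h x, (congrArg (List.map _) hx).trans List.map_append⟩
  map_val := by
    rintro p s ⟨x, hx, hp⟩
    exact ⟨PathwiseEmbedding.toFun h x, by rw [List.getLast?_map, hx]; rfl,
      PathwiseEmbedding.map_val h p x hp⟩
  reflect_val := by
    rintro p s ⟨y, hy, hp⟩
    rw [List.getLast?_map, Option.map_eq_some_iff] at hy
    obtain ⟨x, hx, rfl⟩ := hy
    exact ⟨x, hx, PathwiseEmbedding.reflect_val h p x hp⟩
  map_root := by
    apply Subtype.ext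
    exact congrArg (fun x => [x]) (PathwiseEmbedding.map_root h)

lemma endpoint_comp_unravelMap {C : KripkeModel Var} (h : C ⟶ A) (s : Q.toKripke ⟶ unravel k C) :
    endpoint (s ≫ unravelMap k h) = PathwiseEmbedding.toFun h (endpoint s) :=
  List.getLast_map _

end Sections

/-! ### Trivial fibrations of presheaves over paths -/

section TrivialFibrations

variable {Var : Type u} {X Y : PathPresheaf Var} {f : X ⟶ Y}

/-- Lifting against the inclusion of the empty presheaf in a representable. -/
lemma surjective_of_trivialFibration (hf : trivialFibrations _ f) (Q : (Path Var)ᵒᵖ) :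
    Function.Surjective (f.app Q) := by
  intro y
  rw [trivialFibrations_eq] at hf
  have : Mono (initial.to (yoneda.obj Q.unop : PathPresheaf Var)) := inferInstance
  have := hf _ this
  have sq : CommSq (initial.to X) (initial.to (yoneda.obj Q.unop : PathPresheaf Var)) f
    (yonedaEquiv.symm y) := ⟨Subsingleton.elim _ _⟩
  refine ⟨yonedaEquiv sq.lift, ?_⟩
  rw [← yonedaEquiv_comp, sq.fac_right, Equiv.apply_symm_apply]

/-- Lifting against `yoneda.map i`, which is a monomorphism because there is at most one arrow
between two paths. -/
lemma exists_lift_of_trivialFibration (hf : trivialFibrations _ f) {P Q : Path Var} (i : P ⟶ Q)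
    (x : X.obj (op P)) (y : Y.obj (op Q)) (h : Y.map i.op y = f.app _ x) :
    ∃ z, X.map i.op z = x ∧ f.app _ z = y := by
  rw [trivialFibrations_eq] at hf
  have hi : Mono i := ⟨fun _ _ _ => Subsingleton.elim _ _⟩
  have : Mono (yoneda.map i) := inferInstance
  have := hf _ this
  have sq : CommSq (yonedaEquiv.symm x) (yoneda.map i) f (yonedaEquiv.symm y) := ⟨by
    apply yonedaEquiv.injective
    rw [← yonedaEquiv_naturality, yonedaEquiv_comp, Equiv.apply_symm_apply,
      Equiv.apply_symm_apply, h]⟩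
  refine ⟨yonedaEquiv sq.lift, ?_, ?_⟩
  · rw [yonedaEquiv_naturality, sq.fac_left, Equiv.apply_symm_apply]
  · rw [← yonedaEquiv_comp, sq.fac_right, Equiv.apply_symm_apply]

section Lift

variable {A Z : PathPresheaf Var} (i : A ⟶ Z) (a : A ⟶ X) (b : Z ⟶ Y) (w : a ≫ f = i ≫ b)
  (h₀ : ∀ (v : Var → Fin (0 + 1) → Prop), Function.Surjective (f.app (op ⟨0, v⟩)))
  (h₁ : ∀ (n : ℕ) (v : Var → Fin (n + 1 + 1) → Prop) (x : X.obj (op (Path.trunc n v)))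
    (y : Y.obj (op ⟨n + 1, v⟩)), Y.map (Path.truncHom n v).op y = f.app _ x →
      ∃ z, X.map (Path.truncHom n v).op z = x ∧ f.app _ z = y)

include w in
lemma app_eq_of_comm {Q : (Path Var)ᵒᵖ} {x : A.obj Q} {z : Z.obj Q} (h : i.app Q x = z) :
    f.app Q (a.app Q x) = b.app Q z := by
  rw [← h]
  exact congrArg (fun t : A ⟶ Y => t.app Q x) w

open Classical in
/-- A lift of `b` along `f` extending `a`, by recursion on the length of paths. -/
noncomputable def liftAux : ∀ (n : ℕ) (v : Var → Fin (n + 1) → Prop)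
    (z : Z.obj (op ⟨n, v⟩)), { x : X.obj (op ⟨n, v⟩) // f.app _ x = b.app _ z }
  | 0, v, z => if h : ∃ x, i.app _ x = z then
      ⟨a.app _ h.choose, app_eq_of_comm i a b w h.choose_spec⟩
    else ⟨(h₀ v (b.app _ z)).choose, (h₀ v (b.app _ z)).choose_spec⟩
  | n + 1, v, z => if h : ∃ x, i.app _ x = z then
      ⟨a.app _ h.choose, app_eq_of_comm i a b w h.choose_spec⟩
    else
      -- The equation carried in the subtype is what lets the lift already found on the truncation
      -- serve as input to `h₁`.
      have e := h₁ n v (liftAux n (fun p i => v p i.castSucc) (Z.map (Path.truncHom n v).op z)).1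
        (b.app _ z) ((NatTrans.naturality_apply b _ z).symm.trans
          (liftAux n (fun p i => v p i.castSucc) (Z.map (Path.truncHom n v).op z)).2.symm)
      ⟨e.choose, e.choose_spec.2⟩

lemma liftAux_incl [Mono i] (n : ℕ) (v : Var → Fin (n + 1) → Prop) (x : A.obj (op ⟨n, v⟩)) :
    (liftAux i a b w h₀ h₁ n v (i.app _ x)).1 = a.app _ x := by
  have hi : Function.Injective (i.app (op ⟨n, v⟩)) := (mono_iff_injective i).1 inferInstance _
  have h : ∃ x', i.app _ x' = i.app (op ⟨n, v⟩) x := ⟨x, rfl⟩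
  cases n <;> rw [liftAux, dif_pos h] <;> exact congrArg _ (hi h.choose_spec)

lemma map_liftAux_succ [Mono i] (n : ℕ) (v : Var → Fin (n + 1 + 1) → Prop)
    (z : Z.obj (op ⟨n + 1, v⟩)) :
    X.map (Path.truncHom n v).op (liftAux i a b w h₀ h₁ (n + 1) v z).1 =
      (liftAux i a b w h₀ h₁ n (fun p i => v p i.castSucc)
        (Z.map (Path.truncHom n v).op z)).1 := by
  by_cases h : ∃ x, i.app _ x = z
  · obtain ⟨x, rfl⟩ := h
    rw [liftAux_incl, ← NatTrans.naturality_apply, ← NatTrans.naturality_apply]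
    exact (liftAux_incl i a b w h₀ h₁ n _ _).symm
  · rw [liftAux, dif_neg h]
    exact (h₁ n v _ (b.app _ z) ((NatTrans.naturality_apply b _ z).symm.trans
      (liftAux i a b w h₀ h₁ n (fun p i => v p i.castSucc)
        (Z.map (Path.truncHom n v).op z)).2.symm)).choose_spec.1

/-- Naturality. An arrow into a path of length `n + 1` is either an identity or factors through the
truncation, so compatibility with truncations implies it by induction. -/
lemma map_liftAux [Mono i] (n : ℕ) (v : Var → Fin (n + 1) → Prop) (z : Z.obj (op ⟨n, v⟩))
    (P : Path Var) (g : P ⟶ ⟨n, v⟩) :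
    X.map g.op (liftAux i a b w h₀ h₁ n v z).1 =
      (liftAux i a b w h₀ h₁ P.length P.val (Z.map g.op z)).1 := by
  have key : ∀ (Q : Path Var) (g : P ⟶ Q) (z : Z.obj (op Q)), P.length = Q.length →
      X.map g.op (liftAux i a b w h₀ h₁ Q.length Q.val z).1 =
        (liftAux i a b w h₀ h₁ P.length P.val (Z.map g.op z)).1 := by
    intro Q g z h
    obtain rfl := Path.eq_of_hom g h
    obtain rfl : g = 𝟙 P := Subsingleton.elim _ _
    rw [op_id, X.map_id, Z.map_id]
    rfl
  induction n with
  | zero => exact key ⟨0, v⟩ g z (Nat.le_zero.1 (Path.length_le g))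
  | succ n ih =>
    by_cases h : P.length ≤ n
    · obtain ⟨g', hg⟩ : ∃ g', g = g' ≫ Path.truncHom n v :=
        ⟨(Path.exists_hom_trunc g h).some, Subsingleton.elim _ _⟩
      have e := ih (fun p i => v p i.castSucc) (Z.map (Path.truncHom n v).op z) g'
      rw [← map_liftAux_succ] at e
      rw [hg, op_comp, X.map_comp, Z.map_comp]
      exact e
    · exact key ⟨n + 1, v⟩ g z (le_antisymm (Path.length_le g) (by change n + 1 ≤ _; omega))

include h₀ h₁ in
-- A lift against any monomorphism is built by recursion on path length: it is prescribed on the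
-- image of the monomorphism and chosen elsewhere over the lift of the truncated section.
lemma trivialFibration_of_lift_trunc : trivialFibrations _ f := by
  rw [trivialFibrations_eq]
  intro A Z i (hi : Mono i)
  constructor
  intro a b sq
  refine ⟨⟨{ app := fun Q => TypeCat.ofHom fun z =>
               (liftAux i a b sq.w h₀ h₁ Q.unop.length Q.unop.val z).1
             naturality := ?_ }, ?_, ?_⟩⟩
  · intro Q P g
    ext z
    exact (map_liftAux i a b sq.w h₀ h₁ _ _ z P.unop g.unop).symm
  · ext Q x
    exact liftAux_incl i a b sq.w h₀ h₁ _ _ x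
  · ext Q z
    exact (liftAux i a b sq.w h₀ h₁ _ _ z).2

end Lift

/-- A pathwise embedding which has the back property of bisimulations at the points of rank at most
`k - 2` induces a trivial fibration between unravellings to depth `k`. -/
lemma trivialFibration_unravelMap {A C : KripkeModel Var} (h : C ⟶ A) (k : ℕ+)
    (rank : C.carrier → ℕ) (rank_root : rank C.root = 0)
    (rank_acc : ∀ c c', C.acc c c' → rank c' = rank c + 1)
    (back : ∀ c x, rank c + 2 ≤ k → A.acc (PathwiseEmbedding.toFun h c) x →
      ∃ c', C.acc c c' ∧ PathwiseEmbedding.toFun h c' = x) :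
    trivialFibrations _ ((restrictedYoneda Var).map (unravelMap k h)) := by
  -- The rank counts steps from the root, so the bound in `back` becomes a bound on path length.
  have rank_endpoint : ∀ (n : ℕ) (v : Var → Fin (n + 1) → Prop)
      (s : (⟨n, v⟩ : Path Var).toKripke ⟶ unravel k C), rank (endpoint s) = n := by
    intro n
    induction n with
    | zero =>
      intro v s
      rw [endpoint_zero s rfl, rank_root]
    | succ n ih =>
      intro v s
      rw [rank_acc _ _ (acc_endpoint (Path.truncHom n v) rfl s)]
      exact congrArg (· + 1) (ih _ (restrict (Path.truncHom n v) s))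
  have hval : ∀ c p, C.val p c ↔ A.val p (PathwiseEmbedding.toFun h c) := fun c p =>
    ⟨PathwiseEmbedding.map_val h p c, PathwiseEmbedding.reflect_val h p c⟩
  have lift_zero : ∀ (v : Var → Fin (0 + 1) → Prop)
      (y : (⟨0, v⟩ : Path Var).toKripke ⟶ unravel k A),
      ∃ s : (⟨0, v⟩ : Path Var).toKripke ⟶ unravel k C, s ≫ unravelMap k h = y := by
    intro v y
    obtain ⟨s⟩ : Nonempty ((⟨0, v⟩ : Path Var).toKripke ⟶ unravel k C) := by
      refine exists_hom_unravel_zero rfl fun p => ?_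
      rw [← val_endpoint y, endpoint_zero _ rfl, hval, PathwiseEmbedding.map_root h]
    exact ⟨s, hom_unravel_eq_of_length_zero rfl _ _⟩
  have lift_succ : ∀ (n : ℕ) (v : Var → Fin (n + 1 + 1) → Prop)
      (s : (Path.trunc n v).toKripke ⟶ unravel k C)
      (y : (⟨n + 1, v⟩ : Path Var).toKripke ⟶ unravel k A),
      restrict (Path.truncHom n v) y = s ≫ unravelMap k h →
      ∃ t : (⟨n + 1, v⟩ : Path Var).toKripke ⟶ unravel k C,
        restrict (Path.truncHom n v) t = s ∧ t ≫ unravelMap k h = y := by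
    intro n v s y hsy
    have hacc := acc_endpoint (Path.truncHom n v) rfl y
    rw [hsy, endpoint_comp_unravelMap] at hacc
    -- The path to be lifted has `n + 2` points, so `back` is only called at an endpoint of rank `n
    -- ≤ k - 2`.
    have hk : n + 2 ≤ k := length_lt y
    obtain ⟨c, hc, hcy⟩ := back _ _ ((congrArg (· + 2) (rank_endpoint _ _ s)).trans_le hk) hacc
    obtain ⟨t, ht, htc⟩ := exists_extend_hom_unravel (Path.truncHom n v) rfl hk s c hc
      fun p => by rw [← val_endpoint y, ← hcy, hval]
    refine ⟨t, ht, hom_unravel_ext (Path.truncHom n v) rfl ?_ ?_⟩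
    · rw [hsy, ← ht, restrict_comp]
    · rw [endpoint_comp_unravelMap, htc, hcy]
  exact trivialFibration_of_lift_trunc (f := (restrictedYoneda Var).map (unravelMap k h))
    lift_zero lift_succ

end TrivialFibrations

/-! ### Spans of trivial fibrations from bisimulations -/

section Span

variable {Var : Type u} {A B : KripkeModel Var}

/-- The Kripke model of pairs of points related by a relation which may depend on a depth, together
with the depth. -/
def relationModel (S : ℕ → A.carrier → B.carrier → Prop) (h : S 0 A.root B.root) :
    KripkeModel Var where
  carrier := { t : ULift.{u} ℕ × A.carrier × B.carrier // S t.1.down t.2.1 t.2.2 }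
  acc s t := t.1.1.down = s.1.1.down + 1 ∧ A.acc s.1.2.1 t.1.2.1 ∧ B.acc s.1.2.2 t.1.2.2
  val p t := A.val p t.1.2.1
  root := ⟨(⟨0⟩, A.root, B.root), h⟩

variable (S : ℕ → A.carrier → B.carrier → Prop) (h : S 0 A.root B.root)

/-- The first projection. -/
def relationModelFst : relationModel S h ⟶ A where
  toFun t := t.1.2.1
  map_acc _ _ h := h.2.1
  map_val _ _ h := h
  reflect_val _ _ h := h
  map_root := rfl

/-- The second projection. -/
def relationModelSnd (hv : ∀ n x y, S n x y → ∀ p, A.val p x ↔ B.val p y) :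
    relationModel S h ⟶ B where
  toFun t := t.1.2.2
  map_acc _ _ h := h.2.2
  map_val p t h := (hv _ _ _ t.2 p).1 h
  reflect_val p t h := (hv _ _ _ t.2 p).2 h
  map_root := rfl

/-- The back property of the first projection is the forth property of `S`: a successor in `A` must
be completed to a related pair one level deeper. The stored depth is the rank. -/
lemma trivialFibration_relationModelFst (k : ℕ+)
    (forth : ∀ (n : ℕ) x y x', n + 2 ≤ k → S n x y → A.acc x x' → ∃ y', B.acc y y' ∧ S (n + 1) x' y') :
    trivialFibrations _ ((restrictedYoneda Var).map (unravelMap k (relationModelFst S h))) := by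
  refine trivialFibration_unravelMap _ k (fun t => t.1.1.down) rfl (fun _ _ h => h.1) ?_
  rintro ⟨⟨⟨n⟩, x, y⟩, hS⟩ x' hn hx
  obtain ⟨y', hy, hS'⟩ := forth n x y x' hn hS hx
  exact ⟨⟨(⟨n + 1⟩, x', y'), hS'⟩, ⟨rfl, hx, hy⟩, rfl⟩

lemma trivialFibration_relationModelSnd (k : ℕ+)
    (hv : ∀ n x y, S n x y → ∀ p, A.val p x ↔ B.val p y)
    (back : ∀ (n : ℕ) x y y', n + 2 ≤ k → S n x y → B.acc y y' → ∃ x', A.acc x x' ∧ S (n + 1) x' y') :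
    trivialFibrations _ ((restrictedYoneda Var).map (unravelMap k (relationModelSnd S h hv))) := by
  refine trivialFibration_unravelMap _ k (fun t => t.1.1.down) rfl (fun _ _ h => h.1) ?_
  rintro ⟨⟨⟨n⟩, x, y⟩, hS⟩ y' hn hy
  obtain ⟨x', hx, hS'⟩ := back n x y y' hn hS hy
  exact ⟨⟨(⟨n + 1⟩, x', y'), hS'⟩, ⟨rfl, hx, hy⟩, rfl⟩

lemma moritaEquivalent_unravel_of_boundedBisimilar (k : ℕ+)
    (h : BoundedBisimilar A B (k - 1) A.root B.root) :
    MoritaEquivalent ((chain A).obj k) ((chain B).obj k) := by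
  -- Sequences with at most `k` entries allow `k - 1` steps, so `k - 1 - n` rounds remain at depth
  -- `n`.
  let S : ℕ → A.carrier → B.carrier → Prop := fun n => BoundedBisimilar A B (k - 1 - n)
  -- While `n + 2 ≤ k` the subtraction is not truncated at zero and a round is left to play.
  have hS : ∀ n : ℕ, n + 2 ≤ k → (k : ℕ) - 1 - n = k - 1 - (n + 1) + 1 := fun n hn => by omega
  refine ⟨_, _, _, trivialFibration_relationModelFst S h k fun n x y x' hn hxy hx => ?_,
    trivialFibration_relationModelSnd S h k (fun _ _ _ h => h.val) fun n x y y' hn hxy hy => ?_⟩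
  · change BoundedBisimilar A B _ x y at hxy
    rw [hS n hn] at hxy
    exact hxy.2.1 x' hx
  · change BoundedBisimilar A B _ x y at hxy
    rw [hS n hn] at hxy
    exact hxy.2.2 y' hy

/-- The chain of partial unravellings is functorial. -/
def chainMap (f : A ⟶ B) : chain A ⟶ chain B where
  app k := (restrictedYoneda Var).map (unravelMap k f)
  naturality _ _ _ := rfl

lemma moritaEquivalent_chain_of_bisimilar (h : Bisimilar A B) :
    MoritaEquivalent (chain A) (chain B) := by
  obtain ⟨Z, hroot, hval, hforth, hback⟩ := h
  -- The relation ignores depth, but the depth stored in `relationModel` still supplies the rank.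
  -- One model then serves all levels, which makes the two legs maps of chains.
  let S : ℕ → A.carrier → B.carrier → Prop := fun _ => Z
  have hf := fun k => trivialFibration_relationModelFst S hroot k
    fun n x y x' _ hxy hx => hforth x y x' hxy hx
  have hg := fun k => trivialFibration_relationModelSnd S hroot k (fun _ => hval)
    fun n x y y' _ hxy hy => hback x y y' hxy hy
  exact ⟨_, chainMap (relationModelFst S hroot), chainMap (relationModelSnd S hroot fun _ => hval),
    ⟨fun k => (hf k).1, fun k => (hf k).2⟩, ⟨fun k => (hg k).1, fun k => (hg k).2⟩⟩

end Span

/-! ### Bisimulations from spans of trivial fibrations -/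

section OfSpan

variable {Var : Type u} {A B : KripkeModel Var} {k : ℕ+} {X : PathPresheaf Var} {Q : Path Var}

/-- The last point of the path in `A` lying under a section of `X`. -/
def endpointUnder (f : X ⟶ (chain A).obj k) (z : X.obj (op Q)) : A.carrier :=
  endpoint (Q := Q) (k := k) (f.app (op Q) z)

/-- Both legs send `z` to an embedding of the same path `Q`, whose last valuation is thus that of
either endpoint. -/
lemma val_endpointUnder (f : X ⟶ (chain A).obj k) (g : X ⟶ (chain B).obj k) (z : X.obj (op Q))
    (p : Var) : A.val p (endpointUnder f z) ↔ B.val p (endpointUnder g z) :=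
  (val_endpoint _ p).trans (val_endpoint _ p).symm

/-- Supplies the starting position: a one-point path carrying the valuation of the root can only be
sent to the root, whichever leg is applied. -/
lemma exists_section_zero {f : X ⟶ (chain A).obj k} (hf : trivialFibrations _ f) :
    ∃ (Q : Path Var) (z : X.obj (op Q)), Q.length = 0 ∧
      ∀ (B : KripkeModel Var) (g : X ⟶ (chain B).obj k), endpointUnder g z = B.root := by
  let Q : Path Var := ⟨0, fun p _ => A.val p A.root⟩
  obtain ⟨s⟩ : Nonempty (Q.toKripke ⟶ unravel k A) := exists_hom_unravel_zero rfl fun p => Iff.rfl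
  obtain ⟨z, -⟩ := surjective_of_trivialFibration hf (op Q) s
  exact ⟨Q, z, rfl, fun B g => endpoint_zero _ rfl⟩

/-- One move of the game: the path under `z` is prolonged in `A` and lifted to the apex, and the
other leg maps the lift to a matching move. Exchanging the legs turns forth into back. -/
lemma exists_section_succ {f : X ⟶ (chain A).obj k} (hf : trivialFibrations _ f) (z : X.obj (op Q))
    (hk : Q.length + 2 ≤ k) (x : A.carrier) (hx : A.acc (endpointUnder f z) x) :
    ∃ (Q' : Path Var) (z' : X.obj (op Q')), Q'.length = Q.length + 1 ∧ endpointUnder f z' = x ∧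
      ∀ (B : KripkeModel Var) (g : X ⟶ (chain B).obj k),
        B.acc (endpointUnder g z) (endpointUnder g z') := by
  obtain ⟨t, ht, htx⟩ := exists_prolongation (k := k) (Q := Q) (f.app (op Q) z) hk x hx
  obtain ⟨z', hz, hz'⟩ := exists_lift_of_trivialFibration hf (Q.extendHom _) z t ht
  refine ⟨_, z', rfl, (congrArg (endpoint (k := k) (A := A)) hz').trans htx, fun B g => ?_⟩
  have h := acc_endpoint (k := k) (A := B) (Q.extendHom _) rfl (g.app _ z')
  -- Naturality of `g`: the reply in `B` prolongs the path already under `z`.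
  have e : restrict (Q.extendHom _) (g.app _ z') = g.app (op Q) z :=
    (NatTrans.naturality_apply g (Q.extendHom _).op z').symm.trans (congrArg _ hz)
  exact (congrArg (fun s => B.acc (endpoint (k := k) (A := B) (Q := Q) s) _) e).mp h

/-- The bound says that `n` further points can be added to the `Q.length + 1` points of `Q` within
depth `k`, one for each round. -/
lemma boundedBisimilar_endpointUnder {f : X ⟶ (chain A).obj k} {g : X ⟶ (chain B).obj k}
    (hf : trivialFibrations _ f) (hg : trivialFibrations _ g) (n : ℕ) (Q : Path Var)
    (z : X.obj (op Q)) (hk : Q.length + n + 1 ≤ k) :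
    BoundedBisimilar A B n (endpointUnder f z) (endpointUnder g z) := by
  induction n generalizing Q with
  | zero => exact val_endpointUnder f g z
  | succ n ih =>
    refine ⟨val_endpointUnder f g z, fun x hx => ?_, fun y hy => ?_⟩
    · obtain ⟨Q', z', hQ, rfl, h⟩ := exists_section_succ hf z (by omega) x hx
      exact ⟨_, h B g, ih Q' z' (by omega)⟩
    · obtain ⟨Q', z', hQ, rfl, h⟩ := exists_section_succ hg z (by omega) y hy
      exact ⟨_, h A f, ih Q' z' (by omega)⟩

lemma boundedBisimilar_of_moritaEquivalent_unravel (n : ℕ)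
    (h : MoritaEquivalent ((chain A).obj n.succPNat) ((chain B).obj n.succPNat)) :
    BoundedBisimilar A B n A.root B.root := by
  obtain ⟨X, f, g, hf, hg⟩ := h
  obtain ⟨Q, z, hQ, hz⟩ := exists_section_zero hf
  have := boundedBisimilar_endpointUnder hf hg n Q z (by rw [Nat.succPNat_coe]; omega)
  rwa [hz, hz] at this

lemma bisimilar_of_moritaEquivalent_chain (h : MoritaEquivalent (chain A) (chain B)) :
    Bisimilar A B := by
  obtain ⟨X, f, g, hf, hg⟩ := h
  have hf : ∀ n, trivialFibrations _ (f.app n) := fun n => ⟨hf.1 n, hf.2 n⟩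
  have hg : ∀ n, trivialFibrations _ (g.app n) := fun n => ⟨hg.1 n, hg.2 n⟩
  -- Moving a section up the chain keeps its endpoints, as the inclusions of unravellings leave
  -- sequences unchanged.
  have nat : ∀ (C : KripkeModel Var) (h : X ⟶ chain C) {m n : ℕ+} (hmn : m ≤ n) (Q : Path Var)
      (z : (X.obj m).obj (op Q)),
      endpointUnder (h.app n) ((X.map (homOfLE hmn)).app (op Q) z) = endpointUnder (h.app m) z := by
    intro C h m n hmn Q z
    have e : (h.app n).app (op Q) ((X.map (homOfLE hmn)).app (op Q) z) =
        ((chain C).map (homOfLE hmn)).app (op Q) ((h.app m).app (op Q) z) :=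
      congrArg (fun t : X.obj m ⟶ (chain C).obj n => t.app (op Q) z) (h.naturality (homOfLE hmn))
    exact congrArg (endpoint (k := n) (A := C)) e
  -- A section at level `m` lies over a path with at most `m` points, so one level higher there is
  -- always room for another.
  have room : ∀ (m : ℕ+) (Q : Path Var) (z : (X.obj m).obj (op Q)), Q.length + 2 ≤ (m + 1 : ℕ+) :=
    fun m Q z => by
      have := length_lt (k := m) (A := A) (Q := Q) ((f.app m).app _ z)
      rw [PNat.add_coe, PNat.one_coe]
      omega
  -- The bisimulation consists of the endpoint pairs under apex sections of all levels together;
  -- every move is answered one level up.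
  refine ⟨fun x y => ∃ (n : ℕ+) (Q : Path Var) (z : (X.obj n).obj (op Q)),
    endpointUnder (f.app n) z = x ∧ endpointUnder (g.app n) z = y, ?_, ?_, ?_, ?_⟩
  · obtain ⟨Q, z, -, hz⟩ := exists_section_zero (hf 1)
    exact ⟨1, Q, z, hz A (f.app 1), hz B (g.app 1)⟩
  · rintro _ _ ⟨n, Q, z, rfl, rfl⟩
    exact val_endpointUnder _ _ z
  · rintro _ _ x' ⟨n, Q, z, rfl, rfl⟩ hx
    have hn : n ≤ n + 1 := (PNat.lt_add_right n 1).le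
    rw [← nat A f hn] at hx
    obtain ⟨Q', z', -, hz', h⟩ := exists_section_succ (hf (n + 1)) _ (room n Q z) x' hx
    have hacc := h B (g.app _)
    rw [nat B g hn] at hacc
    exact ⟨_, hacc, _, Q', z', hz', rfl⟩
  · rintro _ _ y' ⟨n, Q, z, rfl, rfl⟩ hy
    have hn : n ≤ n + 1 := (PNat.lt_add_right n 1).le
    rw [← nat B g hn] at hy
    obtain ⟨Q', z', -, hz', h⟩ := exists_section_succ (hg (n + 1)) _ (room n Q z) y' hy
    have hacc := h A (f.app _)
    rw [nat A f hn] at hacc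
    exact ⟨_, hacc, _, Q', z', rfl, hz'⟩

end OfSpan

/-! ### Morita equivalence in terms of bisimilarity and modal equivalence -/

variable {Var : Type u} {A B : KripkeModel Var}

theorem moritaEquivalent_chain_iff_bisimilar :
    MoritaEquivalent (chain A) (chain B) ↔ Bisimilar A B :=
  ⟨bisimilar_of_moritaEquivalent_chain, moritaEquivalent_chain_of_bisimilar⟩

theorem levelwiseMoritaEquivalent_chain_iff_modallyEquivalent [Finite Var] :
    LevelwiseMoritaEquivalent (chain A) (chain B) ↔ ModallyEquivalent A B := by
  rw [modallyEquivalent_iff_forall_boundedBisimilar]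
  -- Level `n + 1` corresponds to `n` rounds in this direction, and level `k` to `k - 1` rounds in
  -- the other.
  exact ⟨fun h n => boundedBisimilar_of_moritaEquivalent_unravel n (h _),
    fun h k => moritaEquivalent_unravel_of_boundedBisimilar k (h _)⟩

end ModalHomotopy

theorem proposition6p2 {Var : Type u} [Finite Var] (A B : ModalHomotopy.KripkeModel Var) :
    (ModalHomotopy.ModallyEquivalent A B → ModalHomotopy.Bisimilar A B) ↔
      (ModalHomotopy.LevelwiseMoritaEquivalent (ModalHomotopy.chain A) (ModalHomotopy.chain B) →
        ModalHomotopy.MoritaEquivalent (ModalHomotopy.chain A) (ModalHomotopy.chain B)) := by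
  rw [ModalHomotopy.moritaEquivalent_chain_iff_bisimilar,
    ModalHomotopy.levelwiseMoritaEquivalent_chain_iff_modallyEquivalent]
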